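/- Let $K$ be a number field with algebraic closure $\overline{K}$. For $k, b \in K^*$ let $\phi_{k,b}(x) = k(x^2+b)/x \in K(x)$, a rational map of degree $2$ on $\mathbb{P}^1(\overline{K})$. A rational map is called post-critically finite if each of its critical points in $\mathbb{P}^1(\overline{K})$ has a finite forward orbit. If $\phi_{k,b}$ is post-critically finite, then the absolute multiplicative height of $k$ is at most $2$, that is, $$\Bigl(\prod_{v \in M_K} \max\{1, |k|_v\}^{n_v}\Bigr)^{1/[K:\mathbb{Q}]} \le 2,$$ where $M_K$ is the set of places of $K$ and $n_v = [K_v : \mathbb{Q}_v]$. In particular, the set of $k \in K^*$ for which $\phi_{k,b}$ is post-critically finite for some $b \in K^*$ is finite. Hence for each fixed $b \in K^*$ only finitely many of the maps $\phi_{k,b}$ with $k \in K^*$ are post-critically finite, and, as $k$ and $b$ both vary over $K^*$, the post-critically finite maps $\phi_{k,b}$ fall into finitely many conjugacy classes under $\mathrm{PGL}_2(\overline{K})$. -/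

import Mathlib

open Polynomial

noncomputable section

namespace RationalMap

variable {K : Type*} [Field K] (L : Type*) [Field L] [Algebra K L]

/-- The degree `max (deg p) (deg q)` of a rational function `φ = p / q` in lowest terms. -/
def degree (φ : RatFunc K) : ℕ :=
  max φ.num.natDegree φ.denom.natDegree

/-- The numerator of `φ` in lowest terms, over the extension `L`. -/
def numOver (φ : RatFunc K) : L[X] :=
  φ.num.map (algebraMap K L)

/-- The denominator of `φ` in lowest terms, over the extension `L`. -/
def denomOver (φ : RatFunc K) : L[X] :=
  φ.denom.map (algebraMap K L)

open Classical in
/-- The self-map of the projective line `ℙ¹(L) = L ∪ {∞}` given by a rational function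
`φ = p / q ∈ K(x)`. In homogeneous coordinates this is `[X, Y] ↦ [P(X, Y), Q(X, Y)]`, where `P`, `Q`
are the homogenizations of `p`, `q` in degree `d = degree φ`; so `P(1, 0)` and `Q(1, 0)` are the
coefficients of `x ^ d` in `p` and in `q`. -/
def map (φ : RatFunc K) (z : OnePoint L) : OnePoint L :=
  z.elim
    (if (denomOver L φ).coeff (degree φ) = 0 then OnePoint.infty
      else (((numOver L φ).coeff (degree φ) / (denomOver L φ).coeff (degree φ) : L) : OnePoint L))
    (fun a ↦ if (denomOver L φ).eval a = 0 then OnePoint.infty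
      else (((numOver L φ).eval a / (denomOver L φ).eval a : L) : OnePoint L))

/-- For a map `p / q` in lowest terms, the polynomial whose roots are the finite points of the fiber
above `w`: it is `p - c q` for `w = c` finite and `q` for `w = ∞`. -/
def fiberPoly {L : Type*} [Field L] (p q : L[X]) (w : OnePoint L) : L[X] :=
  w.elim q (fun c ↦ p - C c * q)

/-- The ramification index of `φ` (assumed non-constant) at `z ∈ ℙ¹(L)`: the multiplicity of `z` in
the fiber of `φ` above `φ z`. At `z = ∞` it is computed in the coordinate `1 / x`, in which `φ` is the
quotient of `x ^ d * p (1 / x)` and `x ^ d * q (1 / x)` with `d = degree φ`. -/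
def ramificationIndex (φ : RatFunc K) (z : OnePoint L) : ℕ :=
  z.elim
    ((fiberPoly ((numOver L φ).reflect (degree φ)) ((denomOver L φ).reflect (degree φ))
      (map L φ OnePoint.infty)).rootMultiplicity 0)
    (fun a ↦ (fiberPoly (numOver L φ) (denomOver L φ)
      (map L φ (a : OnePoint L))).rootMultiplicity a)

/-- A critical point of `φ` in `ℙ¹(L)` is a point at which `φ` is ramified. -/
def IsCriticalPoint (φ : RatFunc K) (z : OnePoint L) : Prop :=
  2 ≤ ramificationIndex L φ z

variable {L}

/-- `φ ∈ K(x)` is post-critically finite if every critical point of `φ` in `ℙ¹` of the algebraic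
closure of `K` has a finite forward orbit under `φ`. -/
def PostCriticallyFinite (φ : RatFunc K) : Prop :=
  ∀ z : OnePoint (AlgebraicClosure K), IsCriticalPoint (AlgebraicClosure K) φ z →
    (Set.range fun n : ℕ ↦ (map (AlgebraicClosure K) φ)^[n] z).Finite

open Classical in
/-- `φ` and `ψ` are conjugate over the algebraic closure of `K`: there is a Möbius transformation
`g` with coefficients in the algebraic closure such that `ψ = g ∘ φ ∘ g⁻¹` on `ℙ¹`. -/
def IsConjugate (φ ψ : RatFunc K) : Prop :=
  ∃ g : GL (Fin 2) (AlgebraicClosure K), ∀ z : OnePoint (AlgebraicClosure K),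
    map (AlgebraicClosure K) ψ z = g • map (AlgebraicClosure K) φ (g⁻¹ • z)

/-- The rational function `k (x² + b) / x`. -/
def family (k b : K) : RatFunc K :=
  RatFunc.C k * (RatFunc.X ^ 2 + RatFunc.C b) / RatFunc.X

/-- The absolute multiplicative height
`(∏_v max(1, |k|_v) ^ n_v) ^ (1 / [K : ℚ])` of an element of a number field `K`.
`Height.mulHeight₁` is the product over the places, each weighted by its local degree `n_v`. -/
def absoluteHeight [NumberField K] (k : K) : ℝ :=
  Height.mulHeight₁ k ^ ((Module.finrank ℚ K : ℝ)⁻¹)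

end RationalMap

end

/-! In the coordinate `u = c / x` with `c² = b`, the map becomes `F u = a u / (1 + u²)` with `a =
k⁻¹`, independent of `b`. It fixes `0` with multiplier `a`, and `1` is critical with value `a / 2`.
A finite orbit of `1` restricts `a` at each place. At an infinite place `|a| ≥ 1`
(`infinite_orbit_of_norm_lt_one`): otherwise `0` is attracting and must attract an infinite critical
orbit, since inverse branches of all `F^n` on a fixed disk would be uniformly bounded with
derivatives `a⁻ⁿ` at `0`. At a finite place `|a| ≥ |2|` (`infinite_orbit_of_isNonarchimedean`):
otherwise `a / 2` lies in the open unit disk, where `F` scales absolute values by `|a| < 1`. So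
`max(1, |k|) ≤ max(1, |1/2|)` at every place, and `H(k) ≤ H(1/2) = 2`. Northcott gives finiteness in
`k`; scaling `x` removes `b` up to conjugacy. -/

/-- The map `u ↦ a u / (1 + u²)`, which is `x ↦ a⁻¹ (x + 1 / x)` in the coordinate `u = 1 / x`.
With the convention `1 / 0 = 0` the poles `u² = -1` are sent to the fixed point `0`, which is where
their second iterates lie. -/
def reciprocalMap {F : Type*} [Field F] (a u : F) : F :=
  a * u / (1 + u ^ 2)

namespace reciprocalMap

/-! ### Symmetries and fibers of the reciprocal map -/

section Field

variable {F : Type*} [Field F] {a : F}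

lemma zero_right (a : F) : reciprocalMap a 0 = 0 := by simp [reciprocalMap]

lemma one_right (a : F) : reciprocalMap a 1 = a / 2 := by
  norm_num [reciprocalMap]

lemma neg_right (a u : F) : reciprocalMap a (-u) = -reciprocalMap a u := by
  simp [reciprocalMap, neg_div]

lemma inv_right (a u : F) : reciprocalMap a u⁻¹ = reciprocalMap a u := by
  rcases eq_or_ne u 0 with rfl | hu
  · simp
  · have : 1 + u⁻¹ ^ 2 = (1 + u ^ 2) * u⁻¹ ^ 2 := by field_simp; ring
    rw [reciprocalMap, reciprocalMap, this]
    by_cases h : 1 + u ^ 2 = 0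
    · simp [h]
    · field_simp

lemma iterate_zero_right (a : F) (n : ℕ) : (reciprocalMap a)^[n] 0 = 0 :=
  Function.iterate_fixed (zero_right a) n

lemma iterate_neg_right (a u : F) (n : ℕ) :
    (reciprocalMap a)^[n] (-u) = -(reciprocalMap a)^[n] u :=
  (Function.Commute.iterate_left (g := Neg.neg) (fun u ↦ neg_right a u) n).eq u

lemma map_iterate {E : Type*} [Field E] (f : F →+* E) (a u : F) (n : ℕ) :
    f ((reciprocalMap a)^[n] u) = (reciprocalMap (f a))^[n] (f u) :=
  (Function.Semiconj.iterate_right (f := f) (fun u ↦ by simp [reciprocalMap]) n).eq u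

lemma eq_or_mul_eq_one (ha : a ≠ 0) {x y : F} (hx : 1 + x ^ 2 ≠ 0) (hy : 1 + y ^ 2 ≠ 0)
    (h : reciprocalMap a x = reciprocalMap a y) : x = y ∨ x * y = 1 := by
  rw [reciprocalMap, reciprocalMap, div_eq_div_iff hx hy] at h
  have : a * ((x - y) * (1 - x * y)) = 0 := by linear_combination h
  rcases mul_eq_zero.mp ((mul_eq_zero.mp this).resolve_left ha) with h | h
  · exact .inl (sub_eq_zero.mp h)
  · exact .inr (sub_eq_zero.mp h).symm

end Field

/-! ### Archimedean places: inverse branches at an attracting fixed point -/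

open Metric Set

lemma one_add_sq_ne_zero {w : ℂ} (hw : ‖w‖ < 1) : 1 + w ^ 2 ≠ 0 := by
  intro h
  have h1 : ‖w ^ 2‖ = 1 := by
    rw [show w ^ 2 = -1 by linear_combination h]; simp
  rw [norm_pow] at h1
  nlinarith [norm_nonneg w]

/-- A holomorphic function without zeros on a disk has a holomorphic square root. -/
lemma exists_sqrt_of_differentiableOn_ball {h : ℂ → ℂ} {r : ℝ} {a : ℂ}
    (hd : DifferentiableOn ℂ h (ball 0 r)) (h0 : ∀ u ∈ ball 0 r, h u ≠ 0) (hr : 0 < r)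
    (ha : h 0 = a ^ 2) :
    ∃ s : ℂ → ℂ, DifferentiableOn ℂ s (ball 0 r) ∧ s 0 = a ∧ ∀ u ∈ ball 0 r, s u ^ 2 = h u := by
  -- A primitive `l` of `h' / h` serves as a logarithm: `h * exp (-l)` is constant.
  have hd' : DifferentiableOn ℂ (fun u ↦ deriv h u / h u) (ball 0 r) :=
    (hd.deriv isOpen_ball).div hd h0
  obtain ⟨l, hl0, hl⟩ := hd'.isExactOn_ball.with_val_at 0 0
  have key : ∀ w ∈ ball (0 : ℂ) r, HasDerivAt (fun z ↦ h z * Complex.exp (-l z)) 0 w := by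
    intro w hw
    refine (((hd.differentiableAt (isOpen_ball.mem_nhds hw)).hasDerivAt).mul
      (hl w hw).fun_neg.cexp).congr_deriv ?_
    have := h0 w hw
    field_simp
    ring
  have hexp : EqOn (fun w ↦ h w * Complex.exp (-l w)) (fun _ ↦ a ^ 2) (ball 0 r) :=
    isOpen_ball.eqOn_of_deriv_eq (convex_ball 0 r).isPreconnected
      (fun w hw ↦ (key w hw).differentiableAt.differentiableWithinAt)
      (differentiableOn_const _) (fun _ hw ↦ by simp [(key _ hw).deriv])
      (mem_ball_self hr) (by simp [hl0, ha])
  refine ⟨fun u ↦ a * Complex.exp (l u / 2), fun u hu ↦ ?_, by simp [hl0], fun u hu ↦ ?_⟩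
  · exact (((hl u hu).div_const 2).cexp.const_mul a).differentiableAt.differentiableWithinAt
  · have h1 : h u * Complex.exp (-l u) = a ^ 2 := hexp hu
    rw [mul_pow, ← Complex.exp_nat_mul, ← h1, mul_assoc, ← Complex.exp_add]
    push_cast
    rw [show -l u + 2 * (l u / 2) = 0 by ring, Complex.exp_zero, mul_one]

section Complex

variable {a : ℂ} {r : ℝ}

lemma norm_le_norm (hr1 : r < 1) {w : ℂ} (hw : w ∈ ball (0 : ℂ) r) (ha : ‖a‖ ≤ 1 - r ^ 2) :
    ‖reciprocalMap a w‖ ≤ ‖w‖ := by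
  rw [mem_ball_zero_iff] at hw
  have h1 : 1 - r ^ 2 ≤ ‖1 + w ^ 2‖ := by
    have := norm_sub_le (1 + w ^ 2) (w ^ 2)
    rw [add_sub_cancel_right, norm_one, norm_pow] at this
    nlinarith [norm_nonneg w]
  have h0 : 0 < ‖1 + w ^ 2‖ := norm_pos_iff.mpr (one_add_sq_ne_zero (hw.trans hr1))
  rw [reciprocalMap, norm_div, norm_mul, div_le_iff₀ h0, mul_comm]
  exact mul_le_mul_of_nonneg_left (ha.trans h1) (norm_nonneg w)

lemma mapsTo_ball (hr1 : r < 1) (ha : ‖a‖ ≤ 1 - r ^ 2) :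
    MapsTo (reciprocalMap a) (ball 0 r) (ball 0 r) := fun _ hw ↦
  mem_ball_zero_iff.mpr ((norm_le_norm hr1 hw ha).trans_lt (mem_ball_zero_iff.mp hw))

lemma continuousOn_ball (hr1 : r < 1) : ContinuousOn (reciprocalMap a) (ball 0 r) :=
  ContinuousOn.div (by fun_prop) (by fun_prop) fun _ hw ↦
    one_add_sq_ne_zero ((mem_ball_zero_iff.mp hw).trans hr1)

/-- If the forward orbit of the critical value `a / 2` meets the disk of radius `r` at most in the
attracting fixed point `0`, then every iterate has a holomorphic inverse branch on this disk. -/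
theorem exists_inverse_branch (ha0 : a ≠ 0) (hr0 : 0 < r) (hr1 : r < 1) (ha : ‖a‖ ≤ 1 - r ^ 2)
    (hP : ∀ n, (reciprocalMap a)^[n] (a / 2) ∈ ball 0 r → (reciprocalMap a)^[n] (a / 2) = 0)
    (n : ℕ) :
    ∃ g : ℂ → ℂ, DifferentiableOn ℂ g (ball 0 r) ∧ g 0 = 0 ∧ HasDerivAt g (a⁻¹ ^ n) 0 ∧
      (∀ u ∈ ball 0 r, (reciprocalMap a)^[n] (g u) = u) ∧
      ∀ w ∈ ball 0 r, g ((reciprocalMap a)^[n] w) = w := by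
  induction n with
  | zero => exact ⟨id, differentiableOn_id, rfl, by simpa using hasDerivAt_id (0 : ℂ),
      fun _ _ ↦ rfl, fun _ _ ↦ rfl⟩
  | succ n ih =>
    obtain ⟨g, hgd, hg0, hg', hFg, hgF⟩ := ih
    have h0 : (0 : ℂ) ∈ ball (0 : ℂ) r := mem_ball_self hr0
    have hg_zero : ∀ u ∈ ball (0 : ℂ) r, g u = 0 → u = 0 := fun u hu h ↦ by
      rw [← hFg u hu, h, iterate_zero_right]
    -- `g` avoids both critical values `±a / 2`, the zeros of the discriminant `a² - 4 g²` of `g w²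
    -- - a w + g = 0`. The next branch is its root `2 g / (a + s)`, a form regular where `g = 0`; `s
    -- 0 = a` selects the root vanishing at `0`.
    have hne : ∀ u ∈ ball (0 : ℂ) r, ∀ c, c = a / 2 ∨ c = -(a / 2) → g u ≠ c := by
      rintro u hu c hc rfl
      have h1 : (reciprocalMap a)^[n] (a / 2) = u ∨ (reciprocalMap a)^[n] (a / 2) = -u := by
        rw [← hFg u hu]
        rcases hc with hc | hc
        · simp [hc]
        · simp [hc, iterate_neg_right]
      have h2 : u = 0 := by
        rcases h1 with h1 | h1
        · rw [← h1]; exact hP n (h1 ▸ hu)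
        · rw [← neg_eq_zero, ← h1]; exact hP n (h1 ▸ by simpa using hu)
      rw [h2, hg0] at hc
      have ha2 : a / 2 ≠ 0 := div_ne_zero ha0 two_ne_zero
      exact hc.elim (fun hc ↦ ha2 hc.symm) fun hc ↦ ha2 (neg_eq_zero.mp hc.symm)
    obtain ⟨s, hsd, hs0, hs⟩ := exists_sqrt_of_differentiableOn_ball
      (h := fun u ↦ a ^ 2 - 4 * g u ^ 2) (r := r) (a := a)
      ((hgd.pow 2).const_mul 4 |>.const_sub _) (fun u hu h ↦ by
        have : (g u - a / 2) * (g u - -(a / 2)) = 0 := by linear_combination -h / 4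
        rcases mul_eq_zero.mp this with h | h
        · exact hne u hu _ (.inl rfl) (sub_eq_zero.mp h)
        · exact hne u hu _ (.inr rfl) (sub_eq_zero.mp h)) hr0 (by simp [hg0])
    have has : ∀ u ∈ ball (0 : ℂ) r, a + s u ≠ 0 := by
      intro u hu h
      have h1 : g u ^ 2 = 0 := by
        have := hs u hu
        rw [show s u = -a by linear_combination h] at this
        linear_combination this / 4
      rw [hg_zero u hu (by simpa using h1), hs0] at h
      exact ha0 (by linear_combination h / 2)
    have hden : ∀ u ∈ ball (0 : ℂ) r,
        1 + (2 * g u / (a + s u)) ^ 2 = 2 * a / (a + s u) := fun u hu ↦ by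
      have := has u hu
      field_simp
      linear_combination hs u hu
    have hden0 : ∀ u ∈ ball (0 : ℂ) r, 1 + (2 * g u / (a + s u)) ^ 2 ≠ 0 := fun u hu ↦ by
      rw [hden u hu]
      exact div_ne_zero (by simpa using ha0) (has u hu)
    have hFg' : ∀ u ∈ ball (0 : ℂ) r, reciprocalMap a (2 * g u / (a + s u)) = g u := fun u hu ↦ by
      rw [reciprocalMap, hden u hu]
      have := has u hu
      field_simp
    have hd : DifferentiableOn ℂ (fun u ↦ 2 * g u / (a + s u)) (ball 0 r) :=
      (hgd.const_mul 2).div (hsd.const_add a) has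
    have hmaps : ∀ m, MapsTo (reciprocalMap a)^[m] (ball 0 r) (ball 0 r) := fun m ↦
      (mapsTo_ball hr1 ha).iterate m
    refine ⟨fun u ↦ 2 * g u / (a + s u), hd, by simp [hg0], ?_, fun u hu ↦ ?_, fun w hw ↦ ?_⟩
    · have hs' := (hsd.differentiableAt (isOpen_ball.mem_nhds h0)).hasDerivAt
      refine ((hg'.const_mul 2).fun_div (hs'.const_add a) (has 0 h0)).congr_deriv ?_
      rw [hs0, hg0, pow_succ a⁻¹ n]
      generalize a⁻¹ ^ n = c
      field_simp
      ring
    · rw [Function.iterate_succ_apply, hFg' u hu, hFg u hu]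
    -- A priori `h w` is `w` or `w⁻¹`. These have norm below and above `1`, so by connectedness and
    -- `h 0 = 0` the second never occurs.
    · set h : ℂ → ℂ := fun w ↦ 2 * g ((reciprocalMap a)^[n + 1] w) /
        (a + s ((reciprocalMap a)^[n + 1] w)) with hh
      have hcont : ContinuousOn h (ball 0 r) :=
        hd.continuousOn.comp ((continuousOn_ball hr1).iterate (mapsTo_ball hr1 ha) (n + 1))
          (hmaps _)
      have hcases : ∀ w ∈ ball (0 : ℂ) r, h w = w ∨ h w * w = 1 := by
        intro w hw
        have hw1 : ‖w‖ < 1 := (mem_ball_zero_iff.mp hw).trans hr1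
        refine eq_or_mul_eq_one ha0 (hden0 _ (hmaps _ hw)) (one_add_sq_ne_zero hw1) ?_
        rw [hh, hFg' _ (hmaps _ hw), Function.iterate_succ_apply, hgF _ (mapsTo_ball hr1 ha hw)]
      have hnorm : ∀ w ∈ ball (0 : ℂ) r, h w * w = 1 → 1 < ‖h w‖ := by
        intro w hw h1
        have hw1 : ‖w‖ < 1 := (mem_ball_zero_iff.mp hw).trans hr1
        have h2 := congrArg norm h1
        rw [norm_mul, norm_one] at h2
        nlinarith [norm_nonneg w, norm_nonneg (h w)]
      refine (hcases w hw).resolve_right fun hw1 ↦ ?_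
      have h00 : h 0 = 0 := by rw [hh]; simp only [iterate_zero_right, hg0, mul_zero, zero_div]
      obtain ⟨z, hz, hz1⟩ := (convex_ball (0 : ℂ) r).isPreconnected.intermediate_value h0 hw
        hcont.norm (show (1 : ℝ) ∈ Icc ‖h 0‖ ‖h w‖ by
          simpa [h00] using (hnorm w hw hw1).le)
      rcases hcases z hz with h1 | h1
      · exact absurd ((congrArg norm h1).symm.trans hz1) ((mem_ball_zero_iff.mp hz).trans hr1).ne
      · exact absurd hz1 (hnorm z hz h1).ne'

/-- The critical point `1` has an infinite orbit if the fixed point `0`, of multiplier `a`, is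
attracting. -/
theorem infinite_orbit_of_norm_lt_one (ha0 : a ≠ 0) (ha1 : ‖a‖ < 1) :
    (range fun n : ℕ ↦ (reciprocalMap a)^[n] 1).Infinite := by
  intro hfin
  obtain ⟨r₁, hr₁, hball⟩ := Metric.isOpen_iff.mp
    (hfin.sdiff (t := {0})).isClosed.isOpen_compl 0 (by simp)
  obtain ⟨r, hr0, hr⟩ : ∃ r, 0 < r ∧ r < min r₁ (1 - ‖a‖) :=
    exists_between (lt_min hr₁ (sub_pos.mpr ha1))
  rw [lt_min_iff] at hr
  have hr1 : r < 1 := hr.2.trans_le (by simp)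
  have har : ‖a‖ ≤ 1 - r ^ 2 := by nlinarith
  have hP : ∀ n, (reciprocalMap a)^[n] (a / 2) ∈ ball 0 r →
      (reciprocalMap a)^[n] (a / 2) = 0 := by
    intro n hn
    have := hball (ball_subset_ball hr.1.le hn)
    by_contra h0
    refine this ⟨⟨n + 1, ?_⟩, h0⟩
    simp only [Function.iterate_succ_apply, one_right]
  -- `r⁻¹ / r` is the Schwarz bound on `g'(0)` for `g` mapping the `r`-disk into the `r⁻¹`-disk.
  obtain ⟨n, hn⟩ := pow_unbounded_of_one_lt (r⁻¹ / r) ((one_lt_inv₀ (norm_pos_iff.mpr ha0)).mpr ha1)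
  obtain ⟨g, hgd, hg0, hg', hFg, hgF⟩ := exists_inverse_branch ha0 hr0 hr1 har hP n
  have hbound : MapsTo g (ball 0 r) (closedBall (g 0) r⁻¹) := by
    intro u hu
    rw [hg0, mem_closedBall_zero_iff]
    by_contra! hlt
    have hgu : (g u)⁻¹ ∈ ball (0 : ℂ) r := by
      rw [mem_ball_zero_iff, norm_inv]
      exact inv_lt_of_inv_lt₀ hr0 hlt
    have h1 : 1 < ‖g u‖ := ((one_lt_inv₀ hr0).mpr hr1).trans hlt
    -- For `n > 0`, `F^n` agrees at `g u` and its inverse, and `g` is a left inverse on the disk;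
    -- `F^0` lacks this symmetry.
    have h2 : g u = (g u)⁻¹ := by
      rw [← hgF _ hgu]
      cases n with
      | zero =>
        have := hFg u hu
        rw [Function.iterate_zero_apply] at this
        rw [this] at h1
        exact absurd h1 ((mem_ball_zero_iff.mp hu).trans hr1).le.not_gt
      | succ n =>
        rw [Function.iterate_succ_apply, inv_right, ← Function.iterate_succ_apply, hFg u hu]
    have h3 := congrArg norm h2
    rw [norm_inv] at h3
    exact absurd (inv_lt_one_of_one_lt₀ h1) (by rw [← h3]; exact h1.le.not_gt)
  have := Complex.norm_deriv_le_div_of_mapsTo_ball hgd hbound hr0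
  rw [hg'.deriv, norm_pow, norm_inv] at this
  exact absurd hn this.not_gt

end Complex

end reciprocalMap

/-! ### Non-archimedean places -/

namespace reciprocalMap

/-- The orbit of the critical point `1` escapes to the attracting fixed point `0` at every
non-archimedean place `v` with `|a|_v < |2|_v`. -/
theorem infinite_orbit_of_isNonarchimedean {F : Type*} [Field F] [NeZero (2 : F)]
    (v : AbsoluteValue F ℝ)
    (hv : IsNonarchimedean v) {a : F} (ha0 : a ≠ 0) (ha : v a < v 2) :
    (Set.range fun n : ℕ ↦ (reciprocalMap a)^[n] 1).Infinite := by
  have h2 : v 2 ≤ 1 := by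
    simpa [one_add_one_eq_two] using hv 1 1
  have ha1 : v a < 1 := ha.trans_le h2
  have hden : ∀ u, v u < 1 → v (1 + u ^ 2) = 1 := by
    intro u hu
    have hu2 : v (u ^ 2) < 1 := by
      rw [map_pow]; exact pow_lt_one₀ (v.nonneg u) hu two_ne_zero
    refine le_antisymm ((hv 1 (u ^ 2)).trans (max_le v.map_one.le hu2.le)) ?_
    have h := hv (1 + u ^ 2) (-u ^ 2)
    rw [show 1 + u ^ 2 + -u ^ 2 = 1 by ring, map_one, neg_eq_neg_one_mul, map_mul, v.map_neg,
      map_one, one_mul] at h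
    exact (le_max_iff.mp h).resolve_right hu2.not_ge
  have hval : ∀ u, v u < 1 → v (reciprocalMap a u) = v a * v u := fun u hu ↦ by
    rw [reciprocalMap, map_div₀, hden u hu, div_one, map_mul]
  have horb : ∀ n, v ((reciprocalMap a)^[n] (a / 2)) = v a ^ n * v (a / 2) ∧
      v ((reciprocalMap a)^[n] (a / 2)) < 1 := by
    have h0 : v (a / 2) < 1 := by
      rw [map_div₀, div_lt_one (v.pos two_ne_zero)]; exact ha
    intro n
    induction n with
    | zero => simpa using h0
    | succ n ih =>
      rw [Function.iterate_succ_apply', hval _ ih.2]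
      refine ⟨by rw [ih.1]; ring, ?_⟩
      exact mul_lt_one_of_nonneg_of_lt_one_left (v.nonneg a) ha1 ih.2.le
  have hpos : 0 < v (a / 2) := v.pos (div_ne_zero ha0 two_ne_zero)
  have hinj : Function.Injective fun n : ℕ ↦ (reciprocalMap a)^[n + 1] 1 := by
    intro m n h
    simp only [Function.iterate_succ_apply, one_right] at h
    have h1 := congrArg v h
    rw [(horb m).1, (horb n).1] at h1
    exact pow_right_injective₀ (v.pos ha0) ha1.ne (mul_right_cancel₀ hpos.ne' h1)
  exact (Set.infinite_range_of_injective hinj).mono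
    (Set.range_subset_iff.mpr fun n ↦ ⟨n + 1, rfl⟩)

end reciprocalMap

/-! ### From local bounds to the height -/

section Height

open NumberField Height

variable {K : Type*} [Field K] [NumberField K]

lemma mulHeight₁_le_mulHeight₁ {x y : K} (hinf : ∀ v : InfinitePlace K, v x ≤ max (v y) 1)
    (hfin : ∀ v : FinitePlace K, v x ≤ max (v y) 1) : mulHeight₁ x ≤ mulHeight₁ y := by
  have hsupp (x : K) : (fun v : FinitePlace K ↦ max (v x) 1).HasFiniteMulSupport := by
    rcases eq_or_ne x 0 with rfl | hx
    · simp [Function.HasFiniteMulSupport, Function.mulSupport]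
    · exact (FinitePlace.hasFiniteMulSupport hx).subset fun v hv h ↦ hv (by simp [h])
  rw [NumberField.mulHeight₁_eq, NumberField.mulHeight₁_eq]
  refine mul_le_mul (Finset.prod_le_prod (fun v _ ↦ by positivity) fun v _ ↦ ?_) ?_ ?_
    (Finset.prod_nonneg fun v _ ↦ by positivity)
  · exact pow_le_pow_left₀ (by positivity) (max_le (hinf v) (le_max_right _ _)) _
  · exact finprod_le_finprod (hsupp x) (fun v ↦ by simp) (hsupp y)
      fun v ↦ max_le (hfin v) (le_max_right _ _)
  · exact finprod_nonneg fun v ↦ by positivity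

lemma mulHeight₁_two : mulHeight₁ (2 : K) = 2 ^ Module.finrank ℚ K := by
  rw [NumberField.mulHeight₁_eq]
  have h1 : ∀ v : FinitePlace K, max (v 2) 1 = 1 := fun v ↦ max_eq_right <| by
    simpa [one_add_one_eq_two] using v.add_le 1 1
  have h2 : ∀ v : InfinitePlace K, max (v 2) 1 = 2 := fun v ↦ by
    rw [← v.norm_embedding_eq, map_ofNat]; norm_num
  simp_rw [h1, h2, finprod_one, mul_one]
  rw [Finset.prod_pow_eq_pow_sum, InfinitePlace.sum_mult_eq]

/-- If the orbit of the critical point `1` of `u ↦ k⁻¹ u / (1 + u²)` is finite, the height of `k` is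
at most that of `2`. -/
theorem mulHeight₁_le_of_finite_orbit {k : K} (hk : k ≠ 0)
    (h : (Set.range fun n : ℕ ↦ (reciprocalMap k⁻¹)^[n] 1).Finite) :
    mulHeight₁ k ≤ 2 ^ Module.finrank ℚ K := by
  rw [← mulHeight₁_two, ← mulHeight₁_inv (2 : K)]
  refine mulHeight₁_le_mulHeight₁ (fun v ↦ le_max_of_le_right ?_) fun v ↦ le_max_of_le_left ?_
  · by_contra! hlt
    refine reciprocalMap.infinite_orbit_of_norm_lt_one (a := v.embedding k⁻¹) (by simpa using hk)
      ?_ ((h.image v.embedding).subset ?_)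
    · rw [v.norm_embedding_eq, map_inv₀]
      exact inv_lt_one_of_one_lt₀ hlt
    · rintro _ ⟨n, rfl⟩
      exact ⟨_, ⟨n, rfl⟩, by simp [reciprocalMap.map_iterate]⟩
  · by_contra! hlt
    refine reciprocalMap.infinite_orbit_of_isNonarchimedean v.val v.add_le (inv_ne_zero hk) ?_ h
    rw [← FinitePlace.coe_apply, ← FinitePlace.coe_apply, map_inv₀]
    rw [map_inv₀] at hlt
    exact inv_lt_of_inv_lt₀ (FinitePlace.pos_iff.mpr two_ne_zero) hlt

end Height

/-! ### The family on the projective line -/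

namespace RationalMap

section Family

variable {K : Type*} [Field K] {k b : K}

lemma family_eq_div (k b : K) :
    family k b = algebraMap K[X] (RatFunc K) (C k * (X ^ 2 + C b)) /
      algebraMap K[X] (RatFunc K) X := by
  simp [family, RatFunc.algebraMap_C, RatFunc.algebraMap_X]

lemma isCoprime_family (hk : k ≠ 0) (hb : b ≠ 0) : IsCoprime (C k * (X ^ 2 + C b)) (X : K[X]) := by
  refine ⟨C (k * b)⁻¹, -C b⁻¹ * X, ?_⟩
  have h1 : (C (k * b)⁻¹ * C k : K[X]) = C b⁻¹ := by
    rw [← C_mul]; congr 1; field_simp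
  have h2 : (C b⁻¹ * C b : K[X]) = 1 := by
    rw [← C_mul, inv_mul_cancel₀ hb, C_1]
  linear_combination (X ^ 2 + C b) * h1 + h2

lemma num_family (hk : k ≠ 0) (hb : b ≠ 0) : (family k b).num = C k * (X ^ 2 + C b) := by
  classical
  have hg : gcd (C k * (X ^ 2 + C b)) (X : K[X]) = 1 := by
    rw [← normalize_gcd]
    exact normalize_eq_one.mpr ((gcd_isUnit_iff _ _).mpr (isCoprime_family hk hb))
  rw [family_eq_div, RatFunc.num_div]
  simp [hg]

lemma denom_family (hk : k ≠ 0) (hb : b ≠ 0) : (family k b).denom = X := by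
  classical
  have hg : gcd (C k * (X ^ 2 + C b)) (X : K[X]) = 1 := by
    rw [← normalize_gcd]
    exact normalize_eq_one.mpr ((gcd_isUnit_iff _ _).mpr (isCoprime_family hk hb))
  rw [family_eq_div, RatFunc.denom_div _ X_ne_zero]
  simp [hg]

lemma degree_family (hk : k ≠ 0) (hb : b ≠ 0) : degree (family k b) = 2 := by
  rw [degree, num_family hk hb, denom_family hk hb, natDegree_C_mul hk, natDegree_X_pow_add_C,
    natDegree_X]
  rfl

variable (L : Type*) [Field L] [Algebra K L]

lemma numOver_family (hk : k ≠ 0) (hb : b ≠ 0) :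
    numOver L (family k b) = C (algebraMap K L k) * (X ^ 2 + C (algebraMap K L b)) := by
  simp [numOver, num_family hk hb]

lemma denomOver_family (hk : k ≠ 0) (hb : b ≠ 0) : denomOver L (family k b) = X := by
  simp [denomOver, denom_family hk hb]

lemma map_family_infty (hk : k ≠ 0) (hb : b ≠ 0) :
    map L (family k b) OnePoint.infty = OnePoint.infty := by
  simp [map, denomOver_family L hk hb, degree_family hk hb, coeff_X]

lemma map_family_zero (hk : k ≠ 0) (hb : b ≠ 0) :
    map L (family k b) ((0 : L) : OnePoint L) = OnePoint.infty := by
  simp [map, denomOver_family L hk hb]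

variable {L} in
lemma map_family_coe (hk : k ≠ 0) (hb : b ≠ 0) {x : L} (hx : x ≠ 0) :
    map L (family k b) (x : OnePoint L) =
      ((algebraMap K L k * (x ^ 2 + algebraMap K L b) / x : L) : OnePoint L) := by
  simp [map, denomOver_family L hk hb, numOver_family L hk hb, hx]

variable {L}

lemma isCriticalPoint_family (hk : k ≠ 0) (hb : b ≠ 0) {c : L} (hc : c ^ 2 = algebraMap K L b) :
    IsCriticalPoint L (family k b) (c : OnePoint L) := by
  have hk' : algebraMap K L k ≠ 0 := by simpa using hk
  have hc0 : c ≠ 0 := by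
    rintro rfl
    exact hb (by simpa using hc.symm)
  have hfib : fiberPoly (numOver L (family k b)) (denomOver L (family k b))
      (map L (family k b) (c : OnePoint L)) = C (algebraMap K L k) * (X - C c) ^ 2 := by
    rw [map_family_coe hk hb hc0, numOver_family L hk hb, denomOver_family L hk hb, ← hc]
    have h1 : algebraMap K L k * (c ^ 2 + c ^ 2) / c = algebraMap K L k * (2 * c) := by
      field_simp; ring
    simp only [fiberPoly, OnePoint.elim_some, h1, C_mul, C_pow, C_ofNat]
    ring
  change 2 ≤ rootMultiplicity c _
  rw [hfib, le_rootMultiplicity_iff (mul_ne_zero (C_ne_zero.mpr hk')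
    (pow_ne_zero 2 (X_sub_C_ne_zero c)))]
  exact dvd_mul_left _ _

/-- The coordinate `c / x` on the projective line, with the value `0` at `x = 0`. -/
def reciprocalCoordinate (c : L) (z : OnePoint L) : L :=
  z.elim 0 fun x ↦ c / x

/-- Sending `x = 0` to `0` is harmless: its image `∞` also has coordinate `0`, and the zeros of `x²
+ b` match the convention `1 / 0 = 0`. -/
lemma reciprocalCoordinate_map_family (hk : k ≠ 0) (hb : b ≠ 0) {c : L}
    (hc : c ^ 2 = algebraMap K L b) (z : OnePoint L) :
    reciprocalCoordinate c (map L (family k b) z) =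
      reciprocalMap (algebraMap K L k⁻¹) (reciprocalCoordinate c z) := by
  have hk' : algebraMap K L k ≠ 0 := by simpa using hk
  induction z using OnePoint.rec with
  | infty => simp [map_family_infty L hk hb, reciprocalCoordinate, reciprocalMap]
  | coe x =>
    rcases eq_or_ne x 0 with rfl | hx
    · simp [map_family_zero L hk hb, reciprocalCoordinate, reciprocalMap]
    · rw [map_family_coe hk hb hx]
      simp only [reciprocalCoordinate, OnePoint.elim_some, reciprocalMap, ← hc, map_inv₀]
      have h : 1 + (c / x) ^ 2 = (x ^ 2 + c ^ 2) / x ^ 2 := by field_simp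
      rw [h]
      by_cases h0 : x ^ 2 + c ^ 2 = 0
      · simp [h0]
      · field_simp

/-- Post-critical finiteness of `k (x² + b) / x`, in the coordinate in which `±1` are the critical
points. -/
theorem PostCriticallyFinite.finite_orbit (hk : k ≠ 0) (hb : b ≠ 0)
    (h : PostCriticallyFinite (family k b)) :
    (Set.range fun n : ℕ ↦ (reciprocalMap k⁻¹)^[n] 1).Finite := by
  obtain ⟨c, hc⟩ := IsAlgClosed.exists_pow_nat_eq (algebraMap K (AlgebraicClosure K) b) two_pos
  have hc0 : c ≠ 0 := by
    rintro rfl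
    exact hb (by simpa using hc.symm)
  refine Set.Finite.of_finite_image (f := algebraMap K (AlgebraicClosure K)) ?_
    (algebraMap K (AlgebraicClosure K)).injective.injOn
  refine ((h c (isCriticalPoint_family hk hb hc)).image (reciprocalCoordinate c)).subset ?_
  rintro _ ⟨_, ⟨n, rfl⟩, rfl⟩
  refine ⟨_, ⟨n, rfl⟩, ?_⟩
  have := Function.Semiconj.iterate_right (f := reciprocalCoordinate c)
    (reciprocalCoordinate_map_family (k := k) hk hb hc) n
  dsimp only
  rw [this.eq, reciprocalMap.map_iterate]
  simp [reciprocalCoordinate, hc0]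

/-- The conjugacy is `x ↦ c x` with `c² = b`. -/
theorem isConjugate_family_one (hk : k ≠ 0) (hb : b ≠ 0) :
    IsConjugate (family k 1) (family k b) := by
  classical
  obtain ⟨c, hc⟩ := IsAlgClosed.exists_pow_nat_eq (algebraMap K (AlgebraicClosure K) b) two_pos
  have hc0 : c ≠ 0 := by
    rintro rfl
    exact hb (by simpa using hc.symm)
  let g : GL (Fin 2) (AlgebraicClosure K) :=
    Matrix.GeneralLinearGroup.mkOfDetNeZero !![c, 0; 0, 1] (by simpa [Matrix.det_fin_two] using hc0)
  have hg_infty : g • (OnePoint.infty : OnePoint (AlgebraicClosure K)) = OnePoint.infty := by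
    rw [OnePoint.smul_infty_eq_self_iff]
    simp [g, Matrix.GeneralLinearGroup.mkOfDetNeZero]
  have hg_coe (x : AlgebraicClosure K) :
      g • (x : OnePoint (AlgebraicClosure K)) = ((c * x : AlgebraicClosure K) : OnePoint _) := by
    rw [OnePoint.smul_some_eq_ite]
    simp [g, Matrix.GeneralLinearGroup.mkOfDetNeZero]
  have hg (z : OnePoint (AlgebraicClosure K)) :
      map (AlgebraicClosure K) (family k b) (g • z) =
        g • map (AlgebraicClosure K) (family k 1) z := by
    induction z using OnePoint.rec with
    | infty => rw [hg_infty, map_family_infty _ hk hb, map_family_infty _ hk one_ne_zero, hg_infty]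
    | coe x =>
      rw [hg_coe]
      rcases eq_or_ne x 0 with rfl | hx
      · rw [mul_zero, map_family_zero _ hk hb, map_family_zero _ hk one_ne_zero, hg_infty]
      · rw [map_family_coe hk hb (mul_ne_zero hc0 hx), map_family_coe hk one_ne_zero hx, hg_coe,
          ← hc, map_one]
        congr 1
        field_simp
  refine ⟨g, fun z ↦ ?_⟩
  convert hg (g⁻¹ • z) using 2
  · rw [smul_inv_smul]

end Family

theorem absoluteHeight_family_le {K : Type*} [Field K] [NumberField K] {k b : K} (hk : k ≠ 0)
    (hb : b ≠ 0) (h : PostCriticallyFinite (family k b)) : absoluteHeight k ≤ 2 := by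
  rw [absoluteHeight]
  refine (Real.rpow_le_rpow (Height.mulHeight₁_nonneg k)
    (mulHeight₁_le_of_finite_orbit hk (h.finite_orbit hk hb)) (by positivity)).trans_eq ?_
  exact Real.pow_rpow_inv_natCast zero_le_two Module.finrank_pos.ne'

end RationalMap

theorem mainTheorem12 (K : Type*) [Field K] [NumberField K] :
    (∀ k b : K, k ≠ 0 → b ≠ 0 →
      RationalMap.PostCriticallyFinite (RationalMap.family k b) →
        RationalMap.absoluteHeight k ≤ 2) ∧
    {k : K | k ≠ 0 ∧ ∃ b : K, b ≠ 0 ∧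
      RationalMap.PostCriticallyFinite (RationalMap.family k b)}.Finite ∧
    (∀ b : K, b ≠ 0 →
      {φ : RatFunc K | RationalMap.PostCriticallyFinite φ ∧
        ∃ k : K, k ≠ 0 ∧ φ = RationalMap.family k b}.Finite) ∧
    (∃ S : Set (RatFunc K), S.Finite ∧ ∀ k b : K, k ≠ 0 → b ≠ 0 →
      RationalMap.PostCriticallyFinite (RationalMap.family k b) →
        ∃ φ ∈ S, RationalMap.IsConjugate φ (RationalMap.family k b)) := by
  have hfin : {k : K | k ≠ 0 ∧ ∃ b : K, b ≠ 0 ∧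
      RationalMap.PostCriticallyFinite (RationalMap.family k b)}.Finite := by
    refine (NumberField.finite_setOfPred_mulHeight₁_le K (2 ^ Module.finrank ℚ K)).subset ?_
    rintro k ⟨hk, b, hb, h⟩
    exact mulHeight₁_le_of_finite_orbit hk (h.finite_orbit hk hb)
  refine ⟨fun k b hk hb h ↦ RationalMap.absoluteHeight_family_le hk hb h, hfin, fun b hb ↦ ?_,
    _, hfin.image fun k ↦ RationalMap.family k 1, fun k b hk hb h ↦
      ⟨_, ⟨k, ⟨hk, b, hb, h⟩, rfl⟩, RationalMap.isConjugate_family_one hk hb⟩⟩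
  refine (hfin.image fun k ↦ RationalMap.family k b).subset ?_
  rintro _ ⟨h, k, hk, rfl⟩
  exact ⟨k, ⟨hk, b, hb, h⟩, rfl⟩
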